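/- **Setting.** Let $I$ (customers) and $J$ (providers) be disjoint finite sets and $A=I\cup J$ the set of agents. A utility function is a map $u:A\times A\to[-1,1]$, written $u_a(a')=u(a,a')$, with $u_a(a)=0$ and $u_a(a')=0$ whenever $a,a'$ are on the same side. For a matching $X\subseteq I\times J$ (a set of pairwise disjoint pairs) let $\mu_X(a)$ be the partner of $a$, and $\mu_X(a)=a$ if $a$ is unmatched. In a market with customers $I'\subseteq I$ and providers $J'\subseteq J$, the *NTU Subset Instability* $I(X;u,I'\cup J')$ of a matching $X\subseteq I'\times J'$ is the minimum of $\sum_{a\in I'\cup J'}s_a$ over all $s\in\mathbb R^{I'\cup J'}$ such that $$\min\bigl(u_i(j)-u_i(\mu_X(i))-s_i,\;u_j(i)-u_j(\mu_X(j))-s_j\bigr)\le 0\quad\text{for all }(i,j)\in I'\times J',$$ $$u_a(\mu_X(a))+s_a\ge 0\ \text{ and }\ s_a\ge 0\quad\text{for all }a\in I'\cup J'.$$ **Learning problem.** In round $t=1,\dots,T$ a set $A^t=I^t\cup J^t$ with $I^t\subseteq I$, $J^t\subseteq J$ arrives (the sequence of these sets is fixed and arbitrary), the platform selects a matching $X^t\subseteq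 I^t\times J^t$, and observes $u_a(\mu_{X^t}(a))+\varepsilon_{a,t}$ for $a\in A^t$, where the random variables $\varepsilon_{a,t}$ ($t\le T$, $a\in A^t$) are independent and $1$-subgaussian, i.e. $\mathbb E\,e^{\lambda\varepsilon_{a,t}}\le e^{\lambda^2/2}$ for all $\lambda\in\mathbb R$. The regret is $R_T=\sum_{t=1}^T I(X^t;u,A^t)$. **Algorithm (MatchNTUUCB).** Fix any version of the Gale–Shapley deferred acceptance algorithm: customer- or provider-proposing, with any order of proposals and any (measurable) rule for breaking ties; staying unmatched has utility $0$. Initially put $C_{a,a'}=[-1,1]$, $\hat u_a(a')=0$ and $n_{ij}=n_{ji}=0$. In round $t$, let $X^t$ be the output of Gale–Shapley on the market $(I^t,J^t)$ with the utilities $u^{\mathrm{UCB}}_a(a')=\max C_{a,a'}$ (with a fixed arbitrary real number in place of the maximum should $C_{a,a'}$ be empty). Then, for each $(i,j)\in X^t$, increase $n_{ij}=n_{ji}$ by one, update the empirical means $\hat u_i(j)$ and $\hat u_j(i)$ of the observed utilities of this pair, and for $(a,a')\in\{(i,j),(j,i)\}$ set $$C_{a,a'}=\Bigl[\hat u_a(a')-8\sqrt{\log(|A|T)/n_{ij}},\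 \hat u_a(a')+8\sqrt{\log(|A|T)/n_{ij}}\Bigr]\cap[-1,1].$$ **Theorem.** There is an absolute constant $C>0$ such that the following holds for all finite sets $I,J$. Such versions of Gale–Shapley exist, and each of them always outputs a matching between the customers and the providers of the given market. For each of them, each number $T$ of rounds, each sequence of arriving sets, each utility function $u$ and each noise as above, the regret of MatchNTUUCB is integrable and $$\mathbb E[R_T]\le C\,|A|^{3/2}\,\sqrt T\,\sqrt{\log(|A|T)} .$$ -/

import Mathlib

open MeasureTheory ProbabilityTheory

/-! Matching markets with non-transferable utilities. The customers are the elements of a finite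
type `I`, the providers those of a finite type `J`, and the agents those of `I ⊕ J`. -/

namespace NTU

section Matching

variable {I J : Type*}

/-- `X` is a matching between the customers in `M` and the providers in `W`: a set of pairwise
disjoint pairs. -/
def IsMatching (M : Finset I) (W : Finset J) (X : Finset (I × J)) : Prop :=
  (∀ p ∈ X, p.1 ∈ M ∧ p.2 ∈ W) ∧
    ∀ p ∈ X, ∀ q ∈ X, p.1 = q.1 ∨ p.2 = q.2 → p = q

open Classical in
/-- The functional representation `μ_X` of a matching `X`: a matched agent is sent to its partner,
an unmatched agent to itself. -/
noncomputable def partner (X : Finset (I × J)) : I ⊕ J → I ⊕ J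
  | Sum.inl i => if h : ∃ j, (i, j) ∈ X then Sum.inr h.choose else Sum.inl i
  | Sum.inr j => if h : ∃ i, (i, j) ∈ X then Sum.inl h.choose else Sum.inr j

/-- The class of unstructured utility functions: `u a b ∈ [-1, 1]`. The two equations are
the standing conventions that an agent gets utility `0` from remaining unmatched (`u a a = 0`) and
that utilities between agents on the same side are `0`. -/
structure IsUnstructured (u : I ⊕ J → I ⊕ J → ℝ) : Prop where
  mem_Icc : ∀ a b, u a b ∈ Set.Icc (-1 : ℝ) 1
  same_side_left : ∀ i i' : I, u (Sum.inl i) (Sum.inl i') = 0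
  same_side_right : ∀ j j' : J, u (Sum.inr j) (Sum.inr j') = 0

/-- The subsidies `s` are feasible for the matching `X` in the market with customers `M` and
providers `W`: after they are paid, there is no blocking pair and `X` is individually rational;
moreover they are nonnegative. -/
def IsFeasibleSubsidy (M : Finset I) (W : Finset J) (u : I ⊕ J → I ⊕ J → ℝ)
    (X : Finset (I × J)) (s : I ⊕ J → ℝ) : Prop :=
  (∀ i ∈ M, ∀ j ∈ W,
    min (u (Sum.inl i) (Sum.inr j) - u (Sum.inl i) (partner X (Sum.inl i)) - s (Sum.inl i))
      (u (Sum.inr j) (Sum.inl i) - u (Sum.inr j) (partner X (Sum.inr j)) - s (Sum.inr j)) ≤ 0) ∧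
  (∀ a ∈ M.disjSum W, 0 ≤ u a (partner X a) + s a) ∧
  ∀ a ∈ M.disjSum W, 0 ≤ s a

/-- NTU Subset Instability of the matching `X` in the market with customers `M` and providers `W`:
the minimum total amount of a feasible subsidy. (The set is never empty, since large subsidies are
feasible, and it is bounded below by `0`.) -/
noncomputable def instability (M : Finset I) (W : Finset J) (u : I ⊕ J → I ⊕ J → ℝ)
    (X : Finset (I × J)) : ℝ :=
  sInf {c | ∃ s : I ⊕ J → ℝ, IsFeasibleSubsidy M W u X s ∧ c = ∑ a ∈ M.disjSum W, s a}

end Matching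

section GaleShapley

/-! The Gale-Shapley deferred acceptance algorithm, with proposers `P` and receivers `R`. It is a
transition system: the order of the proposals and all tie-breaking (between receivers, between
proposers, and between a partner of utility `0` and staying unmatched) is left open, so that
its runs are those of all versions of the algorithm. -/

variable {P R : Type*}

/-- A state of the algorithm: the tentatively matched pairs and the proposals made so far. -/
structure GSState (P R : Type*) where
  held : Finset (P × R)
  proposed : Finset (P × R)

/-- In state `s`, the proposer `p` is not tentatively matched, and `r` is an acceptable receiver
that is most preferred by `p` among those to which `p` has not proposed yet. -/
def GSState.CanPropose (Ps : Finset P) (Rs : Finset R) (v : P → R → ℝ)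
    (s : GSState P R) (p : P) (r : R) : Prop :=
  p ∈ Ps ∧ r ∈ Rs ∧ (∀ r', (p, r') ∉ s.held) ∧ (p, r) ∉ s.proposed ∧ 0 ≤ v p r ∧
    ∀ r' ∈ Rs, (p, r') ∉ s.proposed → v p r' ≤ v p r

/-- One step of the algorithm: `p` proposes to `r`, who keeps the better one of `p` and its current
option (a tentative partner, or staying unmatched with utility `0`).
Here `v p r` is the utility of `p` from `r`, and `w r p` that of `r` from `p`. -/
inductive GSStep [DecidableEq P] [DecidableEq R] (Ps : Finset P) (Rs : Finset R)
    (v : P → R → ℝ) (w : R → P → ℝ) : GSState P R → GSState P R → Prop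
  | accept_free (s : GSState P R) (p : P) (r : R) (h : s.CanPropose Ps Rs v p r)
      (hfree : ∀ q, (q, r) ∉ s.held) (hw : 0 ≤ w r p) :
      GSStep Ps Rs v w s ⟨insert (p, r) s.held, insert (p, r) s.proposed⟩
  | reject_free (s : GSState P R) (p : P) (r : R) (h : s.CanPropose Ps Rs v p r)
      (hfree : ∀ q, (q, r) ∉ s.held) (hw : w r p ≤ 0) :
      GSStep Ps Rs v w s ⟨s.held, insert (p, r) s.proposed⟩
  | accept_replace (s : GSState P R) (p : P) (r : R) (h : s.CanPropose Ps Rs v p r)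
      (q : P) (hq : (q, r) ∈ s.held) (hw : w r q ≤ w r p) :
      GSStep Ps Rs v w s ⟨insert (p, r) (s.held.erase (q, r)), insert (p, r) s.proposed⟩
  | reject_keep (s : GSState P R) (p : P) (r : R) (h : s.CanPropose Ps Rs v p r)
      (q : P) (hq : (q, r) ∈ s.held) (hw : w r p ≤ w r q) :
      GSStep Ps Rs v w s ⟨s.held, insert (p, r) s.proposed⟩

/-- The algorithm may stop: no unmatched proposer has a receiver left that it strictly prefers to
staying unmatched. -/
def GSState.IsFinal (Ps : Finset P) (Rs : Finset R) (v : P → R → ℝ) (s : GSState P R) : Prop :=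
  ∀ p ∈ Ps, (∀ r', (p, r') ∉ s.held) → ∀ r ∈ Rs, (p, r) ∉ s.proposed → v p r ≤ 0

/-- `X` is the output of a run of deferred acceptance, started from the empty state. -/
def IsGSOutput [DecidableEq P] [DecidableEq R] (Ps : Finset P) (Rs : Finset R)
    (v : P → R → ℝ) (w : R → P → ℝ) (X : Finset (P × R)) : Prop :=
  ∃ s : GSState P R, Relation.ReflTransGen (GSStep Ps Rs v w) ⟨∅, ∅⟩ s ∧
    s.IsFinal Ps Rs v ∧ s.held = X

end GaleShapley

section Algorithm

variable {I J : Type*} [DecidableEq I] [DecidableEq J]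

/-- `X` is an output of the Gale-Shapley algorithm on the utilities `v`, in its customer-proposing
or in its provider-proposing form. -/
def IsGSMatching (M : Finset I) (W : Finset J) (v : I ⊕ J → I ⊕ J → ℝ)
    (X : Finset (I × J)) : Prop :=
  IsGSOutput M W (fun i j => v (Sum.inl i) (Sum.inr j)) (fun j i => v (Sum.inr j) (Sum.inl i)) X ∨
  ∃ Y : Finset (J × I),
    IsGSOutput W M (fun j i => v (Sum.inr j) (Sum.inl i)) (fun i j => v (Sum.inl i) (Sum.inr j)) Y ∧
      X = Y.image Prod.swap

/-- `G` is a version of the Gale-Shapley algorithm: a (measurable) rule that assigns to each market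
and each utility function on it the output of a run of the algorithm. -/
structure IsGSVersion (G : Finset I → Finset J → (I ⊕ J → I ⊕ J → ℝ) → Finset (I × J)) : Prop where
  isGSMatching : ∀ M W v, IsGSMatching M W v (G M W v)
  measurable : ∀ M W X, MeasurableSet {v : I ⊕ J → I ⊕ J → ℝ | G M W v = X}

/-- The variables of MatchNTUUCB: `conf a b` and `mean a b` are the confidence set and the empirical
mean for the utility of `a` from `b`, and `count a b = count b a` is the number of rounds in which
`a` and `b` have been matched. -/
structure UCBState (I J : Type*) where
  conf : I ⊕ J → I ⊕ J → Set ℝ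
  mean : I ⊕ J → I ⊕ J → ℝ
  count : I ⊕ J → I ⊕ J → ℕ

/-- Initial values of the variables. -/
def UCBState.init : UCBState I J where
  conf := fun _ _ => Set.Icc (-1) 1
  mean := fun _ _ => 0
  count := fun _ _ => 0

open Classical in
/-- The UCB utilities: `max` of the confidence sets. The confidence sets are compact intervals; the
number `e` is what the algorithm uses instead in the exceptional case of an empty one. -/
noncomputable def UCBState.ucb (e : ℝ) (s : UCBState I J) (a b : I ⊕ J) : ℝ :=
  if (s.conf a b).Nonempty then sSup (s.conf a b) else e

open Classical in
/-- Update of the variables after a round with matching `X` and observed utilities `obs`; `N` is the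
number of agents and `T` the number of rounds. Only the variables of matched pairs change. -/
noncomputable def UCBState.update (N T : ℕ) (X : Finset (I × J)) (obs : I ⊕ J → ℝ)
    (s : UCBState I J) : UCBState I J :=
  let matched (a b : I ⊕ J) : Prop := partner X a = b ∧ a ≠ b
  let count' (a b : I ⊕ J) : ℕ := if matched a b then s.count a b + 1 else s.count a b
  let mean' (a b : I ⊕ J) : ℝ :=
    if matched a b then (s.count a b * s.mean a b + obs a) / (s.count a b + 1) else s.mean a b
  { count := count'
    mean := mean'
    conf := fun a b =>
      if matched a b then
        Set.Icc (mean' a b - 8 * √(Real.log (N * T) / count' a b))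
          (mean' a b + 8 * √(Real.log (N * T) / count' a b)) ∩ Set.Icc (-1) 1
      else s.conf a b }

variable [Fintype I] [Fintype J]

/-- The variables of MatchNTUUCB at the start of round `t` (rounds are numbered from `0`). Here `M t`
and `W t` are the customers and providers that arrive in round `t`, `u` is the true utility function
and `η t a` the noise in the feedback of agent `a` in round `t`; the algorithm has access to
`u` and `η` only through the observed utilities `u a (μ_X a) + η t a`. -/
noncomputable def matchNTUUCB
    (G : Finset I → Finset J → (I ⊕ J → I ⊕ J → ℝ) → Finset (I × J)) (e : ℝ) (T : ℕ)
    (M : ℕ → Finset I) (W : ℕ → Finset J) (u : I ⊕ J → I ⊕ J → ℝ) (η : ℕ → I ⊕ J → ℝ) :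
    ℕ → UCBState I J
  | 0 => UCBState.init
  | t + 1 =>
    let s := matchNTUUCB G e T M W u η t
    let X := G (M t) (W t) (s.ucb e)
    s.update (Fintype.card (I ⊕ J)) T X (fun a => u a (partner X a) + η t a)

/-- The matching that MatchNTUUCB selects in round `t`. -/
noncomputable def chosenMatching
    (G : Finset I → Finset J → (I ⊕ J → I ⊕ J → ℝ) → Finset (I × J)) (e : ℝ) (T : ℕ)
    (M : ℕ → Finset I) (W : ℕ → Finset J) (u : I ⊕ J → I ⊕ J → ℝ) (η : ℕ → I ⊕ J → ℝ)
    (t : ℕ) : Finset (I × J) :=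
  G (M t) (W t) ((matchNTUUCB G e T M W u η t).ucb e)

/-- The regret of MatchNTUUCB over `T` rounds: the cumulative NTU Subset Instability. -/
noncomputable def regret
    (G : Finset I → Finset J → (I ⊕ J → I ⊕ J → ℝ) → Finset (I × J)) (e : ℝ) (T : ℕ)
    (M : ℕ → Finset I) (W : ℕ → Finset J) (u : I ⊕ J → I ⊕ J → ℝ) (η : ℕ → I ⊕ J → ℝ) : ℝ :=
  ∑ t ∈ Finset.range T, instability (M t) (W t) u (chosenMatching G e T M W u η t)

end Algorithm

end NTU

/-! A matching stable for optimistic utilities `g ≥ u` is repaired by paying each matched agent the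
overestimate `g - u` of its partner: every matched agent then receives exactly its optimistic
utility, and a blocking pair under `u` would block under `g` (`instability_le_of_isStable`). So, as
long as the confidence sets contain the true utilities, a round costs at most the total width of the
confidence sets of the matched ordered pairs.

Write `N` for the number of agents and `L = log (N T)`. The width after `n` observations is of order
`√(L / n)`, hence at most a constant times `√L (√(n + 1) - √n)`. The costs of an ordered pair
telescope to `√L √n`, with `n` its final count. There are `N ^ 2` ordered pairs and the counts sum
to at most `T N`, so Cauchy-Schwarz gives `√L √(N ^ 2 · T N) = N ^ (3 / 2) √T √L`
(`regret_le_of_noiseSum_le`).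

The confidence sets can fail only if some noise sum exceeds `8 √(L n)`. The matching of a round
depends on earlier noise alone, so `exp (l Z - l ^ 2 n / 2)`, with `Z` the noise sum of a pair and
`n` its count, is a supermartingale (`lintegral_exp_noiseSum_le_one`). Markov's inequality
(`measure_deviation_le`) and a union bound over rounds, pairs, counts and signs make failure so
unlikely that, with the trivial bound `2 N T` on the regret, it contributes only a constant. -/

namespace NTU

/-! ### Deferred acceptance: stability, termination, dependence on comparisons only. -/

section GaleShapley

variable {P R : Type*}

/-- A set of pairs `X` is stable for the utilities `v` of `P` and `w` of `R`: it is a matching, it is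
individually rational, and there is no blocking pair. -/
structure IsStable (Ps : Finset P) (Rs : Finset R) (v : P → R → ℝ) (w : R → P → ℝ)
    (X : Finset (P × R)) : Prop where
  isMatching : IsMatching Ps Rs X
  rational_left : ∀ p r, (p, r) ∈ X → 0 ≤ v p r
  rational_right : ∀ p r, (p, r) ∈ X → 0 ≤ w r p
  not_blocking : ∀ p ∈ Ps, ∀ r ∈ Rs,
    (v p r ≤ 0 ∨ ∃ r', (p, r') ∈ X ∧ v p r ≤ v p r') ∨
      (w r p ≤ 0 ∨ ∃ q, (q, r) ∈ X ∧ w r p ≤ w r q)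

/-- The properties of the states of deferred acceptance that are preserved by its steps. -/
structure GSState.IsValid (Ps : Finset P) (Rs : Finset R) (v : P → R → ℝ) (w : R → P → ℝ)
    (s : GSState P R) : Prop where
  held_subset : ∀ p r, (p, r) ∈ s.held → (p, r) ∈ s.proposed
  mem_left : ∀ p r, (p, r) ∈ s.proposed → p ∈ Ps
  mem_right : ∀ p r, (p, r) ∈ s.proposed → r ∈ Rs
  right_unique : ∀ p r r', (p, r) ∈ s.held → (p, r') ∈ s.held → r = r'
  left_unique : ∀ p q r, (p, r) ∈ s.held → (q, r) ∈ s.held → p = q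
  rational_left : ∀ p r, (p, r) ∈ s.held → 0 ≤ v p r
  rational_right : ∀ p r, (p, r) ∈ s.held → 0 ≤ w r p
  best : ∀ p r r', (p, r) ∈ s.held → r' ∈ Rs → (p, r') ∉ s.proposed → v p r' ≤ v p r
  rejected : ∀ p r, (p, r) ∈ s.proposed → w r p ≤ 0 ∨ ∃ q, (q, r) ∈ s.held ∧ w r p ≤ w r q

variable [DecidableEq P] [DecidableEq R] {Ps : Finset P} {Rs : Finset R} {v : P → R → ℝ}
  {w : R → P → ℝ}

/-- Proposers go down their lists and the option held by a receiver never gets worse; hence `best`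
and `rejected` persist. -/
theorem GSState.IsValid.step {s s' : GSState P R} (hs : s.IsValid Ps Rs v w)
    (h : GSStep Ps Rs v w s s') : s'.IsValid Ps Rs v w := by
  obtain ⟨h1, h2, h3, h4, h5, h6, h7, h8, h9⟩ := hs
  cases h with
  | accept_free p r h hfree hw =>
    obtain ⟨c1, c2, c3, c4, c5, c6⟩ := h
    constructor <;> simp only [Finset.mem_insert, Prod.mk.injEq] <;> grind
  | reject_free p r h hfree hw =>
    obtain ⟨c1, c2, c3, c4, c5, c6⟩ := h
    constructor <;> simp only [Finset.mem_insert, Prod.mk.injEq] <;> grind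
  | accept_replace p r h q hq hw =>
    obtain ⟨c1, c2, c3, c4, c5, c6⟩ := h
    have := h7 q r hq
    constructor <;> simp only [Finset.mem_insert, Finset.mem_erase, Prod.mk.injEq, ne_eq]
    case rejected =>
      rintro p' r' (⟨rfl, rfl⟩ | hp)
      · exact Or.inr ⟨p', Or.inl ⟨rfl, rfl⟩, le_rfl⟩
      · rcases h9 p' r' hp with h | ⟨q', hq', hw'⟩
        · exact Or.inl h
        · by_cases hr : r' = r
          · subst hr
            -- If the witness was the displaced `q`, the new partner `p` replaces it by
            -- transitivity.
            obtain rfl := h5 _ _ _ hq hq'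
            exact Or.inr ⟨p, Or.inl ⟨rfl, rfl⟩, hw'.trans hw⟩
          · exact Or.inr ⟨q', Or.inr ⟨fun h => hr h.2, hq'⟩, hw'⟩
    all_goals grind
  | reject_keep p r h q hq hw =>
    obtain ⟨c1, c2, c3, c4, c5, c6⟩ := h
    constructor <;> simp only [Finset.mem_insert, Prod.mk.injEq] <;> grind

/-- A pair that was proposed does not block because of the receiver (`rejected`); one that was not
proposed does not block because of the proposer (`best`, or finality if it is unmatched). -/
theorem IsGSOutput.isStable {X : Finset (P × R)} (h : IsGSOutput Ps Rs v w X) :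
    IsStable Ps Rs v w X := by
  obtain ⟨s, hs, hfin, rfl⟩ := h
  have hv : s.IsValid Ps Rs v w := by
    clear hfin
    induction hs with
    | refl => constructor <;> simp
    | tail _ hstep ih => exact ih.step hstep
  refine ⟨⟨fun p hp => ⟨hv.mem_left _ _ (hv.held_subset _ _ hp),
    hv.mem_right _ _ (hv.held_subset _ _ hp)⟩, ?_⟩, hv.rational_left, hv.rational_right, ?_⟩
  · rintro ⟨p, r⟩ hp ⟨q, r'⟩ hq (h | h)
    · obtain rfl : p = q := h
      rw [hv.right_unique _ _ _ hp hq]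
    · obtain rfl : r = r' := h
      rw [hv.left_unique _ _ _ hp hq]
  · intro p hp r hr
    by_cases hpr : (p, r) ∈ s.proposed
    · exact Or.inr (hv.rejected p r hpr)
    · left
      by_cases hm : ∃ r', (p, r') ∈ s.held
      · obtain ⟨r', hr'⟩ := hm
        exact Or.inr ⟨r', hr', hv.best _ _ _ hr' hr hpr⟩
      · exact Or.inl (hfin p hp (by simpa using hm) r hr hpr)

/-- Deferred acceptance terminates: from each state a final one is reachable. -/
theorem exists_isGSOutput (Ps : Finset P) (Rs : Finset R) (v : P → R → ℝ) (w : R → P → ℝ) :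
    ∃ X, IsGSOutput Ps Rs v w X := by
  -- Each step makes a new proposal, so the number of pairs not yet proposed decreases.
  suffices H : ∀ n : ℕ, ∀ s : GSState P R, ((Ps ×ˢ Rs) \ s.proposed).card ≤ n →
      ∃ s', Relation.ReflTransGen (GSStep Ps Rs v w) s s' ∧ s'.IsFinal Ps Rs v by
    obtain ⟨s', h1, h2⟩ := H _ ⟨∅, ∅⟩ le_rfl
    exact ⟨_, s', h1, h2, rfl⟩
  intro n
  induction n with
  | zero =>
    intro s hs
    refine ⟨s, .refl, fun p hp _ r hr hpr => ?_⟩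
    have : (p, r) ∈ (Ps ×ˢ Rs) \ s.proposed := by simp [hp, hr, hpr]
    exact absurd this (by rw [Finset.card_eq_zero.1 (Nat.le_zero.1 hs)]; simp)
  | succ n ih =>
    intro s hs
    by_cases hfin : s.IsFinal Ps Rs v
    · exact ⟨s, .refl, hfin⟩
    obtain ⟨p, hp, hfree, r₀, hr₀, hpr₀, hv₀⟩ : ∃ p ∈ Ps, (∀ r', (p, r') ∉ s.held) ∧
        ∃ r ∈ Rs, (p, r) ∉ s.proposed ∧ 0 < v p r := by
      simpa [GSState.IsFinal] using hfin
    obtain ⟨r, hr, hmax⟩ := Finset.exists_max_image (Rs.filter fun r => (p, r) ∉ s.proposed)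
      (v p) ⟨r₀, by simp [hr₀, hpr₀]⟩
    simp only [Finset.mem_filter, and_imp] at hr hmax
    have hcan : s.CanPropose Ps Rs v p r :=
      ⟨hp, hr.1, hfree, hr.2, hv₀.le.trans (hmax r₀ hr₀ hpr₀), hmax⟩
    have hcard : ((Ps ×ˢ Rs) \ insert (p, r) s.proposed).card ≤ n := by
      have : ((Ps ×ˢ Rs) \ insert (p, r) s.proposed).card < ((Ps ×ˢ Rs) \ s.proposed).card := by
        refine Finset.card_lt_card ⟨fun x => by simp; tauto, fun h => ?_⟩
        have := @h (p, r) (by simp [hp, hr])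
        simp at this
      omega
    have hstep : ∃ K, GSStep Ps Rs v w s ⟨K, insert (p, r) s.proposed⟩ := by
      by_cases hq : ∃ q, (q, r) ∈ s.held
      · obtain ⟨q, hq⟩ := hq
        rcases le_total (w r q) (w r p) with h | h
        · exact ⟨_, .accept_replace s p r hcan q hq h⟩
        · exact ⟨_, .reject_keep s p r hcan q hq h⟩
      · push Not at hq
        rcases le_total 0 (w r p) with h | h
        · exact ⟨_, .accept_free s p r hcan hq h⟩
        · exact ⟨_, .reject_free s p r hcan hq h⟩
    obtain ⟨K, hK⟩ := hstep
    obtain ⟨s', h1, h2⟩ := ih ⟨K, insert (p, r) s.proposed⟩ hcard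
    exact ⟨s', .head hK h1, h2⟩

/-- Deferred acceptance uses only comparisons of utilities of the same agent and with `0`. -/
theorem IsGSOutput.congr {v' : P → R → ℝ} {w' : R → P → ℝ} {X : Finset (P × R)}
    (h : IsGSOutput Ps Rs v w X)
    (hv : ∀ p r r', v p r ≤ v p r' ↔ v' p r ≤ v' p r')
    (hw : ∀ r p p', w r p ≤ w r p' ↔ w' r p ≤ w' r p')
    (hv0 : ∀ p r, 0 ≤ v p r ↔ 0 ≤ v' p r) (hv0' : ∀ p r, v p r ≤ 0 ↔ v' p r ≤ 0)
    (hw0 : ∀ r p, 0 ≤ w r p ↔ 0 ≤ w' r p) (hw0' : ∀ r p, w r p ≤ 0 ↔ w' r p ≤ 0) :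
    IsGSOutput Ps Rs v' w' X := by
  obtain ⟨s, hs, hfin, rfl⟩ := h
  have hcan : ∀ (s : GSState P R) p r, s.CanPropose Ps Rs v p r → s.CanPropose Ps Rs v' p r := by
    rintro s p r ⟨h1, h2, h3, h4, h5, h6⟩
    exact ⟨h1, h2, h3, h4, (hv0 _ _).1 h5, fun r' hr hp => (hv _ _ _).1 (h6 r' hr hp)⟩
  refine ⟨s, Relation.ReflTransGen.mono ?_ _ _ hs,
    fun p hp hfree r hr hpr => (hv0' _ _).1 (hfin p hp hfree r hr hpr), rfl⟩
  intro a b hab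
  cases hab with
  | accept_free p r h hfree h' => exact .accept_free a p r (hcan _ _ _ h) hfree ((hw0 _ _).1 h')
  | reject_free p r h hfree h' => exact .reject_free a p r (hcan _ _ _ h) hfree ((hw0' _ _).1 h')
  | accept_replace p r h q hq h' =>
    exact .accept_replace a p r (hcan _ _ _ h) q hq ((hw _ _ _).1 h')
  | reject_keep p r h q hq h' => exact .reject_keep a p r (hcan _ _ _ h) q hq ((hw _ _ _).1 h')

end GaleShapley

/-! ### Comparison patterns of utilities. -/

section Pattern

variable {I J : Type*}

/-- The outcomes of all comparisons of utilities with one another and with `0`. -/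
def pattern (v : I ⊕ J → I ⊕ J → ℝ) :
    (I ⊕ J → I ⊕ J → I ⊕ J → Prop) × (I ⊕ J → I ⊕ J → Prop) × (I ⊕ J → I ⊕ J → Prop) :=
  (fun a b c => v a b ≤ v a c, fun a b => 0 ≤ v a b, fun a b => v a b ≤ 0)

theorem measurable_pattern : Measurable (pattern (I := I) (J := J)) := by
  have hm : ∀ a b : I ⊕ J, Measurable fun v : I ⊕ J → I ⊕ J → ℝ => v a b := fun a b => by fun_prop
  refine Measurable.prodMk ?_ (Measurable.prodMk ?_ ?_)
  · exact measurable_pi_lambda _ fun a => measurable_pi_lambda _ fun b =>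
      measurable_pi_lambda _ fun c => measurableSet_setOfPred.1 (measurableSet_le (hm a b) (hm a c))
  · exact measurable_pi_lambda _ fun a => measurable_pi_lambda _ fun b =>
      measurableSet_setOfPred.1 (measurableSet_le measurable_const (hm a b))
  · exact measurable_pi_lambda _ fun a => measurable_pi_lambda _ fun b =>
      measurableSet_setOfPred.1 (measurableSet_le (hm a b) measurable_const)

end Pattern

/-! ### Existence of a measurable version of Gale-Shapley. -/

section Version

variable {I J : Type*} [DecidableEq I] [DecidableEq J]

theorem IsStable.swap {Ps : Finset J} {Rs : Finset I} {v : J → I → ℝ} {w : I → J → ℝ}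
    {Y : Finset (J × I)} (h : IsStable Ps Rs v w Y) : IsStable Rs Ps w v (Y.image Prod.swap) := by
  have hmem : ∀ i j, (i, j) ∈ Y.image Prod.swap ↔ (j, i) ∈ Y := by simp
  obtain ⟨⟨h1, h2⟩, h3, h4, h5⟩ := h
  refine ⟨⟨?_, ?_⟩, ?_, ?_, ?_⟩
  · rintro ⟨i, j⟩ hp
    exact (h1 _ ((hmem i j).1 hp)).symm
  · rintro ⟨i, j⟩ hp ⟨i', j'⟩ hq h
    have := h2 _ ((hmem i j).1 hp) _ ((hmem i' j').1 hq) h.symm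
    simp only [Prod.mk.injEq] at this ⊢
    exact this.symm
  · exact fun i j hp => h4 j i ((hmem i j).1 hp)
  · exact fun i j hp => h3 j i ((hmem i j).1 hp)
  · intro i hi j hj
    simpa only [hmem] using (h5 j hj i hi).symm

theorem IsGSMatching.isStable {M : Finset I} {W : Finset J} {v : I ⊕ J → I ⊕ J → ℝ}
    {X : Finset (I × J)} (h : IsGSMatching M W v X) :
    IsStable M W (fun i j => v (Sum.inl i) (Sum.inr j)) (fun j i => v (Sum.inr j) (Sum.inl i)) X := by
  rcases h with h | ⟨Y, h, rfl⟩
  · exact h.isStable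
  · exact h.isStable.swap

theorem IsGSMatching.congr {M : Finset I} {W : Finset J} {v v' : I ⊕ J → I ⊕ J → ℝ}
    {X : Finset (I × J)} (h : IsGSMatching M W v X) (hp : pattern v = pattern v') :
    IsGSMatching M W v' X := by
  simp only [pattern, Prod.mk.injEq, funext_iff, eq_iff_iff] at hp
  obtain ⟨h1, h2, h3⟩ := hp
  rcases h with h | ⟨Y, h, rfl⟩
  · exact Or.inl (h.congr (fun _ _ _ => h1 _ _ _) (fun _ _ _ => h1 _ _ _) (fun _ _ => h2 _ _)
      (fun _ _ => h3 _ _) (fun _ _ => h2 _ _) (fun _ _ => h3 _ _))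
  · exact Or.inr ⟨Y, h.congr (fun _ _ _ => h1 _ _ _) (fun _ _ _ => h1 _ _ _) (fun _ _ => h2 _ _)
      (fun _ _ => h3 _ _) (fun _ _ => h2 _ _) (fun _ _ => h3 _ _), rfl⟩

variable [Fintype I] [Fintype J]

/-- One output is fixed for each comparison pattern, via a representative utility given by
`Function.invFun`. There are finitely many patterns and `pattern` is measurable, so the rule is
measurable; `IsGSMatching.congr` transfers the output from the representative to `v`. -/
theorem exists_isGSVersion :
    ∃ G : Finset I → Finset J → (I ⊕ J → I ⊕ J → ℝ) → Finset (I × J), IsGSVersion G := by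
  classical
  choose F hF using fun (M : Finset I) (W : Finset J) (v : I ⊕ J → I ⊕ J → ℝ) =>
    exists_isGSOutput M W (fun i j => v (Sum.inl i) (Sum.inr j))
      (fun j i => v (Sum.inr j) (Sum.inl i))
  refine ⟨fun M W v => F M W (Function.invFun pattern (pattern v)), fun M W v => ?_,
    fun M W X => ?_⟩
  · exact IsGSMatching.congr (Or.inl (hF M W _)) (Function.invFun_eq ⟨v, rfl⟩)
  · exact measurable_pattern ((Set.toFinite {k | F M W (Function.invFun pattern k) = X}).measurableSet)

end Version

/-! ### Bounds on the NTU Subset Instability. -/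

section Instability

variable {I J : Type*}

/-- The agent `a` is matched to the agent `b` by `X`. -/
def Matched (X : Finset (I × J)) (a b : I ⊕ J) : Prop :=
  partner X a = b ∧ a ≠ b

theorem partner_inl_of_mem {M : Finset I} {W : Finset J} {X : Finset (I × J)}
    (hX : IsMatching M W X) {i : I} {j : J} (h : (i, j) ∈ X) :
    partner X (Sum.inl i) = Sum.inr j := by
  have hex : ∃ j, (i, j) ∈ X := ⟨j, h⟩
  have := hX.2 _ hex.choose_spec _ h (Or.inl rfl)
  simp only [Prod.mk.injEq, true_and] at this
  simp [partner, hex, this]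

theorem partner_inr_of_mem {M : Finset I} {W : Finset J} {X : Finset (I × J)}
    (hX : IsMatching M W X) {i : I} {j : J} (h : (i, j) ∈ X) :
    partner X (Sum.inr j) = Sum.inl i := by
  have hex : ∃ i, (i, j) ∈ X := ⟨i, h⟩
  have := hX.2 _ hex.choose_spec _ h (Or.inr rfl)
  simp only [Prod.mk.injEq, and_true] at this
  simp [partner, hex, this]

theorem partner_inl_eq (X : Finset (I × J)) (i : I) :
    (∃ j, (i, j) ∈ X ∧ partner X (Sum.inl i) = Sum.inr j) ∨ partner X (Sum.inl i) = Sum.inl i := by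
  by_cases h : ∃ j, (i, j) ∈ X
  · exact Or.inl ⟨h.choose, h.choose_spec, by simp [partner, h]⟩
  · exact Or.inr (by simp [partner, h])

theorem partner_inr_eq (X : Finset (I × J)) (j : J) :
    (∃ i, (i, j) ∈ X ∧ partner X (Sum.inr j) = Sum.inl i) ∨ partner X (Sum.inr j) = Sum.inr j := by
  by_cases h : ∃ i, (i, j) ∈ X
  · exact Or.inl ⟨h.choose, h.choose_spec, by simp [partner, h]⟩
  · exact Or.inr (by simp [partner, h])

theorem Matched.mem_disjSum {M : Finset I} {W : Finset J} {X : Finset (I × J)}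
    (hX : IsMatching M W X) {a b : I ⊕ J} (h : Matched X a b) : a ∈ M.disjSum W := by
  obtain ⟨h1, h2⟩ := h
  rcases a with i | j
  · rcases partner_inl_eq X i with ⟨j, hj, -⟩ | h
    · simpa using (hX.1 _ hj).1
    · exact absurd (h.symm.trans h1) h2
  · rcases partner_inr_eq X j with ⟨i, hi, -⟩ | h
    · simpa using (hX.1 _ hi).2
    · exact absurd (h.symm.trans h1) h2

theorem IsUnstructured.self {u : I ⊕ J → I ⊕ J → ℝ} (hu : IsUnstructured u) (a : I ⊕ J) :
    u a a = 0 := by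
  rcases a with i | j
  · exact hu.same_side_left i i
  · exact hu.same_side_right j j

theorem bddBelow_instability (M : Finset I) (W : Finset J) (u : I ⊕ J → I ⊕ J → ℝ)
    (X : Finset (I × J)) :
    BddBelow {c | ∃ s : I ⊕ J → ℝ, IsFeasibleSubsidy M W u X s ∧ c = ∑ a ∈ M.disjSum W, s a} := by
  refine ⟨0, ?_⟩
  rintro c ⟨s, hs, rfl⟩
  exact Finset.sum_nonneg hs.2.2

theorem instability_le {M : Finset I} {W : Finset J} {u : I ⊕ J → I ⊕ J → ℝ}
    {X : Finset (I × J)} {s : I ⊕ J → ℝ} (hs : IsFeasibleSubsidy M W u X s) :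
    instability M W u X ≤ ∑ a ∈ M.disjSum W, s a :=
  csInf_le (bddBelow_instability M W u X) ⟨s, hs, rfl⟩

theorem instability_nonneg (M : Finset I) (W : Finset J) (u : I ⊕ J → I ⊕ J → ℝ)
    (X : Finset (I × J)) : 0 ≤ instability M W u X := by
  refine Real.sInf_nonneg ?_
  rintro c ⟨s, hs, rfl⟩
  exact Finset.sum_nonneg hs.2.2

/-- Two utilities differ by at most `2`, so the constant subsidy `2` is always feasible. This is the
fallback bound when the confidence sets fail. -/
theorem instability_le_card [Fintype I] [Fintype J] (M : Finset I) (W : Finset J)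
    {u : I ⊕ J → I ⊕ J → ℝ} (hu : IsUnstructured u) (X : Finset (I × J)) :
    instability M W u X ≤ 2 * Fintype.card (I ⊕ J) := by
  have hs : IsFeasibleSubsidy M W u X fun _ => 2 := by
    refine ⟨fun i _ j _ => (min_le_left _ _).trans ?_, fun a _ => ?_, fun a _ => by norm_num⟩
    · have h1 := (hu.mem_Icc (Sum.inl i) (Sum.inr j)).2
      have h2 := (hu.mem_Icc (Sum.inl i) (partner X (Sum.inl i))).1
      linarith
    · have h2 := (hu.mem_Icc a (partner X a)).1
      linarith
  refine (instability_le hs).trans ?_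
  rw [Finset.sum_const, nsmul_eq_mul, mul_comm]
  gcongr
  exact Finset.card_le_univ _

open Classical in
/-- A matching that is stable for optimistic utilities `g` has instability at most the total
amount by which `g` overestimates the utilities of the matched agents. -/
theorem instability_le_of_isStable [Fintype I] [Fintype J] {M : Finset I} {W : Finset J}
    {u g : I ⊕ J → I ⊕ J → ℝ} (hu : IsUnstructured u) {X : Finset (I × J)}
    (hX : IsStable M W (fun i j => g (Sum.inl i) (Sum.inr j))
      (fun j i => g (Sum.inr j) (Sum.inl i)) X) (hg : ∀ a b, u a b ≤ g a b) :
    instability M W u X ≤ ∑ a, ∑ b, if Matched X a b then g a b - u a b else 0 := by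
  set s : I ⊕ J → ℝ := fun a => ∑ b, if Matched X a b then g a b - u a b else 0 with hs_def
  have hs0 : ∀ a, 0 ≤ s a := fun a => Finset.sum_nonneg fun b _ => by
    split_ifs
    · exact sub_nonneg.2 (hg a b)
    · exact le_rfl
  have hself : ∀ a, partner X a = a → s a = 0 := fun a ha =>
    Finset.sum_eq_zero fun b _ => if_neg fun h => h.2 (ha.symm.trans h.1)
  have hval : ∀ a, partner X a ≠ a → s a = g a (partner X a) - u a (partner X a) := fun a ha => by
    rw [hs_def]
    simp only
    rw [Finset.sum_eq_single (partner X a), if_pos ⟨rfl, Ne.symm ha⟩]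
    · exact fun b _ hb => if_neg fun h => hb h.1.symm
    · simp
  obtain ⟨hm, hl, hr, hb⟩ := hX
  -- With the subsidy, a matched agent has exactly its optimistic utility from its partner.
  have hil : ∀ i j, (i, j) ∈ X →
      u (Sum.inl i) (partner X (Sum.inl i)) + s (Sum.inl i) = g (Sum.inl i) (Sum.inr j) := by
    intro i j h
    rw [hval _ (by rw [partner_inl_of_mem hm h]; simp), partner_inl_of_mem hm h]
    ring
  have hir : ∀ i j, (i, j) ∈ X →
      u (Sum.inr j) (partner X (Sum.inr j)) + s (Sum.inr j) = g (Sum.inr j) (Sum.inl i) := by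
    intro i j h
    rw [hval _ (by rw [partner_inr_of_mem hm h]; simp), partner_inr_of_mem hm h]
    ring
  have hrat : ∀ a, 0 ≤ u a (partner X a) + s a := by
    rintro (i | j)
    · rcases partner_inl_eq X i with ⟨j, hj, -⟩ | h
      · rw [hil i j hj]
        exact hl i j hj
      · rw [hself _ h, h, hu.self]
        norm_num
    · rcases partner_inr_eq X j with ⟨i, hi, -⟩ | h
      · rw [hir i j hi]
        exact hr i j hi
      · rw [hself _ h, h, hu.self]
        norm_num
  have hfeas : IsFeasibleSubsidy M W u X s := by
    refine ⟨fun i hi j hj => ?_, fun a _ => hrat a, fun a _ => hs0 a⟩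
    have h1 := hg (Sum.inl i) (Sum.inr j)
    have h2 := hg (Sum.inr j) (Sum.inl i)
    have h3 := hrat (Sum.inl i)
    have h4 := hrat (Sum.inr j)
    rw [min_le_iff]
    -- The side that prevents blocking under `g` also does so under `u ≤ g`. If its optimistic
    -- utility from the pair is at most `0`, individual rationality suffices.
    rcases hb i hi j hj with (h | ⟨j', hj', h⟩) | (h | ⟨i', hi', h⟩)
    · left; linarith
    · left; linarith [hil i j' hj']
    · right; linarith
    · right; linarith [hir i' j hi']
  exact (instability_le hfeas).trans
    (Finset.sum_le_sum_of_subset_of_nonneg (Finset.subset_univ _) fun a _ _ => hs0 a)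

open Classical in
theorem sum_matched_le [Fintype I] [Fintype J] (X : Finset (I × J)) :
    (∑ a, ∑ b, if Matched X a b then (1 : ℝ) else 0) ≤ Fintype.card (I ⊕ J) := by
  have : ∀ a : I ⊕ J, (∑ b, if Matched X a b then (1 : ℝ) else 0) ≤ 1 := by
    intro a
    calc (∑ b, if Matched X a b then (1 : ℝ) else 0)
        ≤ ∑ b, if partner X a = b then (1 : ℝ) else 0 := by
          refine Finset.sum_le_sum fun b _ => ?_
          by_cases h : partner X a = b <;> simp [Matched, h]
          split_ifs <;> norm_num
      _ = 1 := by simp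
  calc _ ≤ ∑ _a : I ⊕ J, (1 : ℝ) := Finset.sum_le_sum fun a _ => this a
    _ = _ := by simp

end Instability

/-! ### Recursions for the variables of the algorithm. -/

section State

variable {I J : Type*} [DecidableEq I] [DecidableEq J]

theorem IsGSVersion.isStable {G : Finset I → Finset J → (I ⊕ J → I ⊕ J → ℝ) → Finset (I × J)}
    (hG : IsGSVersion G) (M : Finset I) (W : Finset J) (v : I ⊕ J → I ⊕ J → ℝ) :
    IsStable M W (fun i j => v (Sum.inl i) (Sum.inr j)) (fun j i => v (Sum.inr j) (Sum.inl i))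
      (G M W v) :=
  (hG.isGSMatching M W v).isStable

variable [Fintype I] [Fintype J]
  (G : Finset I → Finset J → (I ⊕ J → I ⊕ J → ℝ) → Finset (I × J)) (e : ℝ) (T : ℕ)
  (M : ℕ → Finset I) (W : ℕ → Finset J) (u : I ⊕ J → I ⊕ J → ℝ) (η : ℕ → I ⊕ J → ℝ)

open Classical in
theorem count_succ (t : ℕ) (a b : I ⊕ J) :
    (matchNTUUCB G e T M W u η (t + 1)).count a b =
      if Matched (chosenMatching G e T M W u η t) a b then
        (matchNTUUCB G e T M W u η t).count a b + 1 else (matchNTUUCB G e T M W u η t).count a b := by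
  by_cases h : Matched (chosenMatching G e T M W u η t) a b
  · rw [if_pos h]
    exact if_pos h
  · rw [if_neg h]
    exact if_neg h

open Classical in
theorem mean_succ (t : ℕ) (a b : I ⊕ J) :
    (matchNTUUCB G e T M W u η (t + 1)).mean a b =
      if Matched (chosenMatching G e T M W u η t) a b then
        ((matchNTUUCB G e T M W u η t).count a b * (matchNTUUCB G e T M W u η t).mean a b +
          (u a b + η t a)) / ((matchNTUUCB G e T M W u η t).count a b + 1)
      else (matchNTUUCB G e T M W u η t).mean a b := by
  by_cases h : Matched (chosenMatching G e T M W u η t) a b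
  · rw [if_pos h]
    refine (if_pos h).trans ?_
    have h1 : partner (chosenMatching G e T M W u η t) a = b := h.1
    rw [← h1]
    rfl
  · rw [if_neg h]
    exact if_neg h

/-- The confidence sets are determined by the numbers of observations and the empirical means. -/
theorem conf_eq (t : ℕ) (a b : I ⊕ J) :
    (matchNTUUCB G e T M W u η t).conf a b =
      if (matchNTUUCB G e T M W u η t).count a b = 0 then Set.Icc (-1) 1 else
        Set.Icc ((matchNTUUCB G e T M W u η t).mean a b - 8 * √(Real.log
            ((Fintype.card (I ⊕ J) : ℕ) * T) / (matchNTUUCB G e T M W u η t).count a b))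
          ((matchNTUUCB G e T M W u η t).mean a b + 8 * √(Real.log
            ((Fintype.card (I ⊕ J) : ℕ) * T) / (matchNTUUCB G e T M W u η t).count a b))
          ∩ Set.Icc (-1) 1 := by
  induction t with
  | zero => simp [matchNTUUCB, UCBState.init]
  | succ t ih =>
    by_cases h : Matched (chosenMatching G e T M W u η t) a b
    · rw [if_neg (by rw [count_succ, if_pos h]; omega)]
      exact if_pos h
    · rw [count_succ, mean_succ, if_neg h, if_neg h, ← ih]
      exact if_neg h

/-- The upper confidence bound as a function of the number of observations and the empirical
mean. -/
theorem ucb_eq (t : ℕ) (a b : I ⊕ J) :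
    (matchNTUUCB G e T M W u η t).ucb e a b =
      if (matchNTUUCB G e T M W u η t).count a b = 0 then 1 else
        if max ((matchNTUUCB G e T M W u η t).mean a b - 8 * √(Real.log
            ((Fintype.card (I ⊕ J) : ℕ) * T) / (matchNTUUCB G e T M W u η t).count a b)) (-1) ≤
          min ((matchNTUUCB G e T M W u η t).mean a b + 8 * √(Real.log
            ((Fintype.card (I ⊕ J) : ℕ) * T) / (matchNTUUCB G e T M W u η t).count a b)) 1
        then min ((matchNTUUCB G e T M W u η t).mean a b + 8 * √(Real.log
            ((Fintype.card (I ⊕ J) : ℕ) * T) / (matchNTUUCB G e T M W u η t).count a b)) 1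
        else e := by
  unfold UCBState.ucb
  rw [conf_eq]
  by_cases h0 : (matchNTUUCB G e T M W u η t).count a b = 0
  · rw [if_pos h0, if_pos h0, if_pos (Set.nonempty_Icc.2 (by norm_num)), csSup_Icc (by norm_num)]
  · rw [if_neg h0, if_neg h0, Set.Icc_inter_Icc]
    simp only [Set.nonempty_Icc]
    split_ifs with h1
    · exact csSup_Icc h1
    · rfl

/-- The sum of the noise that has been observed by `a` in the rounds before `t` in which `a` was
matched to `b`. -/
noncomputable def noiseSum (t : ℕ) (a b : I ⊕ J) : ℝ :=
  (matchNTUUCB G e T M W u η t).count a b * ((matchNTUUCB G e T M W u η t).mean a b - u a b)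

-- Multiplying the running mean by the count turns its update into the addition of one noise term.
open Classical in
theorem noiseSum_succ (t : ℕ) (a b : I ⊕ J) :
    noiseSum G e T M W u η (t + 1) a b =
      if Matched (chosenMatching G e T M W u η t) a b then noiseSum G e T M W u η t a b + η t a
      else noiseSum G e T M W u η t a b := by
  unfold noiseSum
  rw [count_succ, mean_succ]
  split_ifs with h
  · have : ((matchNTUUCB G e T M W u η t).count a b : ℝ) + 1 ≠ 0 := by positivity
    push_cast
    field_simp
    ring
  · rfl

theorem count_le (t : ℕ) (a b : I ⊕ J) : (matchNTUUCB G e T M W u η t).count a b ≤ t := by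
  induction t with
  | zero => simp [matchNTUUCB, UCBState.init]
  | succ t ih =>
    rw [count_succ]
    split_ifs <;> omega

end State

/-! ### Regret when the confidence sets are correct. -/

section GoodEvent

variable {I J : Type*} [DecidableEq I] [DecidableEq J] [Fintype I] [Fintype J]
  {G : Finset I → Finset J → (I ⊕ J → I ⊕ J → ℝ) → Finset (I × J)} {e : ℝ} {T : ℕ}
  {M : ℕ → Finset I} {W : ℕ → Finset J} {u : I ⊕ J → I ⊕ J → ℝ} {η : ℕ → I ⊕ J → ℝ}

/-- This makes the widths telescope. For `n ≥ 1`, `√(n + 1) ≤ (3 / 2) √n` gives `√n (√(n + 1) - √n)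
≥ 2 / 5`, and `40 = 16 / (2 / 5)`. For `n = 0`, `√L ≥ 1 / 2` is enough. -/
theorem min_two_le_sqrt_sub_sqrt {L : ℝ} (hL : 1 / 2 ≤ L) (n : ℕ) :
    (if n = 0 then 2 else 16 * √(L / n)) ≤ 40 * √L * (√((n + 1 : ℕ) : ℝ) - √(n : ℝ)) := by
  have hL1 : (1 : ℝ) / 2 ≤ √L := Real.le_sqrt_of_sq_le (by linarith)
  rcases Nat.eq_zero_or_pos n with rfl | hn
  · simp
    linarith
  · rw [if_neg hn.ne']
    have hn0 : (1 : ℝ) ≤ n := by exact_mod_cast hn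
    have hx : (0 : ℝ) < √(n : ℝ) := Real.sqrt_pos.2 (by linarith)
    have hx2 : √(n : ℝ) ^ 2 = n := Real.sq_sqrt (by linarith)
    have hy2 : √((n + 1 : ℕ) : ℝ) ^ 2 = n + 1 := by
      rw [Real.sq_sqrt (by positivity)]
      push_cast
      ring
    have hy : √((n + 1 : ℕ) : ℝ) ≤ 3 / 2 * √(n : ℝ) :=
      Real.sqrt_le_iff.2 ⟨by positivity, by push_cast; nlinarith⟩
    rw [Real.sqrt_div (by linarith)]
    have key : 2 / 5 ≤ √(n : ℝ) * (√((n + 1 : ℕ) : ℝ) - √(n : ℝ)) := by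
      have h1 : (√((n + 1 : ℕ) : ℝ) - √(n : ℝ)) * (√((n + 1 : ℕ) : ℝ) + √(n : ℝ)) = 1 := by
        linear_combination hy2 - hx2
      have h2 : 0 ≤ √((n + 1 : ℕ) : ℝ) - √(n : ℝ) :=
        sub_nonneg.2 (Real.sqrt_le_sqrt (by push_cast; linarith))
      nlinarith
    calc 16 * (√L / √(n : ℝ)) = 40 * √L * (2 / 5 / √(n : ℝ)) := by ring
      _ ≤ 40 * √L * (√((n + 1 : ℕ) : ℝ) - √(n : ℝ)) := by
        gcongr
        rw [div_le_iff₀ hx]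
        linarith

/-- If the observed noise is small, then the upper confidence bound is at least the utility and
exceeds it by at most the width of the confidence set. -/
theorem ucb_mem_Icc (hu : IsUnstructured u) {t : ℕ} {a b : I ⊕ J}
    (h : |noiseSum G e T M W u η t a b| ≤
      8 * √(Real.log ((Fintype.card (I ⊕ J) : ℝ) * T) * (matchNTUUCB G e T M W u η t).count a b)) :
    u a b ≤ (matchNTUUCB G e T M W u η t).ucb e a b ∧
      (matchNTUUCB G e T M W u η t).ucb e a b - u a b ≤
        if (matchNTUUCB G e T M W u η t).count a b = 0 then 2 else
          16 * √(Real.log ((Fintype.card (I ⊕ J) : ℝ) * T) /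
            (matchNTUUCB G e T M W u η t).count a b) := by
  obtain ⟨hu1, hu2⟩ := hu.mem_Icc a b
  rw [ucb_eq]
  unfold noiseSum at h
  generalize (matchNTUUCB G e T M W u η t).count a b = n at *
  generalize (matchNTUUCB G e T M W u η t).mean a b = m at *
  generalize Real.log ((Fintype.card (I ⊕ J) : ℝ) * T) = L at *
  rcases Nat.eq_zero_or_pos n with rfl | hn
  · simp only [if_true]
    exact ⟨hu2, by linarith⟩
  · rw [if_neg hn.ne', if_neg hn.ne']
    have hn0 : (0 : ℝ) < n := by exact_mod_cast hn
    have hr : √(L * n) = n * √(L / n) := by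
      rw [show L * n = (n : ℝ) ^ 2 * (L / n) by field_simp, Real.sqrt_mul (by positivity),
        Real.sqrt_sq hn0.le]
    -- Dividing by `n` turns the bound on the noise sum into a bound on the error of the mean.
    rw [hr, abs_mul, abs_of_pos hn0, mul_left_comm] at h
    have h' := abs_le.1 (le_of_mul_le_mul_left h hn0)
    set r := 8 * √(L / n) with hr_def
    -- The true utility lies in the confidence set, which is therefore nonempty: the default `e` is
    -- not used.
    have hmem : max (m - r) (-1) ≤ u a b ∧ u a b ≤ min (m + r) 1 :=
      ⟨max_le (by linarith) hu1, le_min (by linarith) hu2⟩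
    rw [if_pos (hmem.1.trans hmem.2)]
    refine ⟨hmem.2, ?_⟩
    have := min_le_left (m + r) 1
    linarith

open Classical in
theorem sum_matched_ucb_sub_le (hu : IsUnstructured u)
    (hL : 1 / 2 ≤ Real.log ((Fintype.card (I ⊕ J) : ℝ) * T)) (a b : I ⊕ J) (n : ℕ)
    (h : ∀ t < n, |noiseSum G e T M W u η t a b| ≤
      8 * √(Real.log ((Fintype.card (I ⊕ J) : ℝ) * T) * (matchNTUUCB G e T M W u η t).count a b)) :
    (∑ t ∈ Finset.range n, if Matched (chosenMatching G e T M W u η t) a b then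
      (matchNTUUCB G e T M W u η t).ucb e a b - u a b else 0) ≤
      40 * √(Real.log ((Fintype.card (I ⊕ J) : ℝ) * T)) *
        √((matchNTUUCB G e T M W u η n).count a b : ℝ) := by
  induction n with
  | zero => simp [matchNTUUCB, UCBState.init]
  | succ n ih =>
    rw [Finset.sum_range_succ, count_succ]
    have ih := ih fun t ht => h t (by omega)
    split_ifs with hm
    · have h1 := (ucb_mem_Icc hu (h n (by omega))).2
      have h2 := min_two_le_sqrt_sub_sqrt hL ((matchNTUUCB G e T M W u η n).count a b)
      linarith
    · simpa using ih

/-- In each round an agent `a` has at most one partner `b`, so at most one count per agent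
increases. -/
theorem sum_count_le (n : ℕ) :
    (∑ a, ∑ b, ((matchNTUUCB G e T M W u η n).count a b : ℝ)) ≤ n * Fintype.card (I ⊕ J) := by
  classical
  induction n with
  | zero => simp [matchNTUUCB, UCBState.init]
  | succ n ih =>
    have h := sum_matched_le (chosenMatching G e T M W u η n)
    have : (∑ a, ∑ b, ((matchNTUUCB G e T M W u η (n + 1)).count a b : ℝ)) =
        (∑ a, ∑ b, ((matchNTUUCB G e T M W u η n).count a b : ℝ)) +
          ∑ a, ∑ b, if Matched (chosenMatching G e T M W u η n) a b then (1 : ℝ) else 0 := by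
      simp only [← Finset.sum_add_distrib]
      refine Finset.sum_congr rfl fun a _ => Finset.sum_congr rfl fun b _ => ?_
      rw [count_succ]
      split_ifs <;> simp
    rw [this]
    push_cast
    linarith

/-- The regret on the event that the observed noise is small. -/
theorem regret_le_of_noiseSum_le (hG : IsGSVersion G) (hu : IsUnstructured u)
    (hL : 1 / 2 ≤ Real.log ((Fintype.card (I ⊕ J) : ℝ) * T))
    (h : ∀ t < T, ∀ a b, |noiseSum G e T M W u η t a b| ≤
      8 * √(Real.log ((Fintype.card (I ⊕ J) : ℝ) * T) * (matchNTUUCB G e T M W u η t).count a b)) :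
    regret G e T M W u η ≤ 40 * √(Real.log ((Fintype.card (I ⊕ J) : ℝ) * T)) *
      √((Fintype.card (I ⊕ J) : ℝ) ^ 2 * (T * Fintype.card (I ⊕ J))) := by
  classical
  -- Cauchy-Schwarz over the ordered pairs of agents.
  have hcs : (∑ p : (I ⊕ J) × (I ⊕ J), √((matchNTUUCB G e T M W u η T).count p.1 p.2 : ℝ)) ≤
      √((Fintype.card (I ⊕ J) : ℝ) ^ 2 * (T * Fintype.card (I ⊕ J))) := by
    refine Real.le_sqrt_of_sq_le ((sq_sum_le_card_mul_sum_sq).trans ?_)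
    simp only [Real.sq_sqrt (Nat.cast_nonneg _)]
    rw [Fintype.sum_prod_type, Finset.card_univ, Fintype.card_prod, Nat.cast_mul, ← sq]
    exact mul_le_mul_of_nonneg_left (sum_count_le T) (by positivity)
  calc regret G e T M W u η
      ≤ ∑ t ∈ Finset.range T, ∑ a, ∑ b, if Matched (chosenMatching G e T M W u η t) a b then
          (matchNTUUCB G e T M W u η t).ucb e a b - u a b else 0 := by
        refine Finset.sum_le_sum fun t ht => ?_
        exact instability_le_of_isStable hu (hG.isStable _ _ _) fun a b =>
          (ucb_mem_Icc hu (h t (Finset.mem_range.1 ht) a b)).1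
    _ = ∑ p : (I ⊕ J) × (I ⊕ J), ∑ t ∈ Finset.range T,
          if Matched (chosenMatching G e T M W u η t) p.1 p.2 then
          (matchNTUUCB G e T M W u η t).ucb e p.1 p.2 - u p.1 p.2 else 0 := by
        rw [Finset.sum_comm (s := Finset.univ)]
        refine Finset.sum_congr rfl fun t _ => ?_
        rw [Fintype.sum_prod_type]
    _ ≤ ∑ p : (I ⊕ J) × (I ⊕ J), 40 * √(Real.log ((Fintype.card (I ⊕ J) : ℝ) * T)) *
        √((matchNTUUCB G e T M W u η T).count p.1 p.2 : ℝ) :=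
        Finset.sum_le_sum fun p _ => sum_matched_ucb_sub_le hu hL p.1 p.2 T fun t ht => h t ht _ _
    _ ≤ _ := by
        rw [← Finset.mul_sum]
        exact mul_le_mul_of_nonneg_left hcs (by positivity)

theorem regret_nonneg (G : Finset I → Finset J → (I ⊕ J → I ⊕ J → ℝ) → Finset (I × J)) (e : ℝ)
    (T : ℕ) (M : ℕ → Finset I) (W : ℕ → Finset J) (u : I ⊕ J → I ⊕ J → ℝ) (η : ℕ → I ⊕ J → ℝ) :
    0 ≤ regret G e T M W u η :=
  Finset.sum_nonneg fun _ _ => instability_nonneg _ _ _ _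

theorem regret_le_card (hu : IsUnstructured u) :
    regret G e T M W u η ≤ 2 * (Fintype.card (I ⊕ J) * T) := by
  calc regret G e T M W u η ≤ ∑ _t ∈ Finset.range T, 2 * (Fintype.card (I ⊕ J) : ℝ) :=
        Finset.sum_le_sum fun t _ => instability_le_card _ _ hu _
    _ = _ := by
      rw [Finset.sum_const, Finset.card_range, nsmul_eq_mul]
      ring

/-- With at most one agent, or without rounds, there is no regret. -/
theorem regret_eq_zero (hG : IsGSVersion G) (hu : IsUnstructured u)
    (h : Fintype.card (I ⊕ J) * T ≤ 1) : regret G e T M W u η = 0 := by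
  classical
  rcases Nat.eq_zero_or_pos T with rfl | hT
  · simp [regret]
  refine Finset.sum_eq_zero fun t _ => le_antisymm ?_ (instability_nonneg _ _ _ _)
  have hc : Fintype.card (I ⊕ J) ≤ 1 := by nlinarith
  have hs : Subsingleton (I ⊕ J) := Fintype.card_le_one_iff_subsingleton.1 hc
  have hst := (hG.isStable (M t) (W t) ((matchNTUUCB G e T M W u η t).ucb e))
  have hne : ∀ (i : I) (j : J), False := fun i j =>
    absurd (Subsingleton.elim (Sum.inl i : I ⊕ J) (Sum.inr j)) (by simp)
  -- No pair `(i, j)` exists, so the conditions on pairs are vacuous even for `g = u`, where the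
  -- overestimates vanish.
  refine (instability_le_of_isStable (g := u) hu ⟨hst.isMatching, ?_, ?_, ?_⟩
    fun _ _ => le_rfl).trans (by simp)
  · exact fun i j => (hne i j).elim
  · exact fun i j => (hne i j).elim
  · exact fun i _ j => (hne i j).elim

end GoodEvent

/-! ### Measurability, for an arbitrary σ-algebra on `Ω` so that it applies to the past as well. -/

section Measurability

variable {I J : Type*} [DecidableEq I] [DecidableEq J] [Fintype I] [Fintype J]
  {G : Finset I → Finset J → (I ⊕ J → I ⊕ J → ℝ) → Finset (I × J)} {e : ℝ} {T : ℕ}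
  {M : ℕ → Finset I} {W : ℕ → Finset J} {u : I ⊕ J → I ⊕ J → ℝ}
  {Ω : Type*} [MeasurableSpace Ω] {η : ℕ → I ⊕ J → Ω → ℝ}

/-- The upper confidence bounds are measurable in counts and means, and there are only finitely many
matchings. -/
theorem measurableSet_chosenMatching_of_measurable (hG : IsGSVersion G) {t : ℕ}
    (hc : ∀ a b, Measurable fun ω => (matchNTUUCB G e T M W u (fun t a => η t a ω) t).count a b)
    (hm : ∀ a b, Measurable fun ω => (matchNTUUCB G e T M W u (fun t a => η t a ω) t).mean a b)
    (S : Set (Finset (I × J))) :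
    MeasurableSet {ω | chosenMatching G e T M W u (fun t a => η t a ω) t ∈ S} := by
  have hucb : Measurable fun ω => (matchNTUUCB G e T M W u (fun t a => η t a ω) t).ucb e := by
    refine measurable_pi_lambda _ fun a => measurable_pi_lambda _ fun b => ?_
    simp only [ucb_eq]
    have hcr : Measurable fun ω =>
        ((matchNTUUCB G e T M W u (fun t a => η t a ω) t).count a b : ℝ) :=
      measurable_from_top.comp (hc a b)
    have hr : Measurable fun ω => 8 * √(Real.log ((Fintype.card (I ⊕ J) : ℕ) * T) /
        (matchNTUUCB G e T M W u (fun t a => η t a ω) t).count a b) :=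
      ((measurable_const.div hcr).sqrt).const_mul 8
    have hmin := ((hm a b).add hr).min (measurable_const (a := (1 : ℝ)))
    refine Measurable.ite (hc a b (measurableSet_singleton 0)) measurable_const ?_
    exact Measurable.ite (measurableSet_le
      (((hm a b).sub hr).max (measurable_const (a := (-1 : ℝ)))) hmin) hmin measurable_const
  have heq : {ω | chosenMatching G e T M W u (fun t a => η t a ω) t ∈ S} =
      ⋃ X ∈ S, (fun ω => (matchNTUUCB G e T M W u (fun t a => η t a ω) t).ucb e) ⁻¹'
        {v | G (M t) (W t) v = X} := by
    ext ω
    simp [chosenMatching]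
  rw [heq]
  exact (Set.toFinite S).measurableSet_biUnion fun X _ => hucb (hG.measurable _ _ X)

/-- The variables of MatchNTUUCB are measurable functions of the noise of the arriving agents in the
preceding rounds. -/
theorem measurable_count_and_mean (hG : IsGSVersion G) (t : ℕ)
    (hη : ∀ s < t, ∀ a ∈ (M s).disjSum (W s), Measurable (η s a)) :
    (∀ a b, Measurable fun ω => (matchNTUUCB G e T M W u (fun t a => η t a ω) t).count a b) ∧
    ∀ a b, Measurable fun ω => (matchNTUUCB G e T M W u (fun t a => η t a ω) t).mean a b := by
  classical
  induction t with
  | zero => exact ⟨fun _ _ => measurable_const, fun _ _ => measurable_const⟩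
  | succ t ih =>
    obtain ⟨hc, hm⟩ := ih fun s hs => hη s (by omega)
    have hset : ∀ a b, MeasurableSet
        {ω | Matched (chosenMatching G e T M W u (fun t a => η t a ω) t) a b} := fun a b =>
      measurableSet_chosenMatching_of_measurable hG hc hm {X | Matched X a b}
    refine ⟨fun a b => ?_, fun a b => ?_⟩
    · simp only [count_succ]
      exact Measurable.ite (hset a b) (measurable_from_top.comp (hc a b)) (hc a b)
    · simp only [mean_succ]
      by_cases ha : a ∈ (M t).disjSum (W t)
      · have hcr : Measurable fun ω =>
            ((matchNTUUCB G e T M W u (fun t a => η t a ω) t).count a b : ℝ) :=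
          measurable_from_top.comp (hc a b)
        refine Measurable.ite (hset a b) ?_ (hm a b)
        exact ((hcr.mul (hm a b)).add ((hη t (by omega) a ha).const_add _)).div (hcr.add_const 1)
      -- The noise of an absent agent need not be measurable, but such an agent is never matched, so
      -- its means do not change.
      · have hno : ∀ ω, ¬ Matched (chosenMatching G e T M W u (fun t a => η t a ω) t) a b :=
          fun ω h => ha (h.mem_disjSum (hG.isStable _ _ _).isMatching)
        simpa only [hno, if_false] using hm a b

theorem measurableSet_chosenMatching (hG : IsGSVersion G) (t : ℕ)
    (hη : ∀ s < t, ∀ a ∈ (M s).disjSum (W s), Measurable (η s a)) (S : Set (Finset (I × J))) :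
    MeasurableSet {ω | chosenMatching G e T M W u (fun t a => η t a ω) t ∈ S} :=
  measurableSet_chosenMatching_of_measurable hG (measurable_count_and_mean hG t hη).1
    (measurable_count_and_mean hG t hη).2 S

theorem measurable_noiseSum (hG : IsGSVersion G) (t : ℕ)
    (hη : ∀ s < t, ∀ a ∈ (M s).disjSum (W s), Measurable (η s a)) (a b : I ⊕ J) :
    Measurable fun ω => noiseSum G e T M W u (fun t a => η t a ω) t a b := by
  obtain ⟨hc, hm⟩ := measurable_count_and_mean (e := e) (T := T) (u := u) hG t hη
  have hcr : Measurable fun ω =>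
      ((matchNTUUCB G e T M W u (fun t a => η t a ω) t).count a b : ℝ) :=
    measurable_from_top.comp (hc a b)
  exact hcr.mul ((hm a b).sub_const _)

theorem measurable_regret (hG : IsGSVersion G)
    (hη : ∀ s < T, ∀ a ∈ (M s).disjSum (W s), Measurable (η s a)) :
    Measurable fun ω => regret G e T M W u (fun t a => η t a ω) := by
  refine Finset.measurable_fun_sum _ fun t ht => fun A _ => ?_
  have ht := Finset.mem_range.1 ht
  exact measurableSet_chosenMatching hG t (fun s hs => hη s (by omega))
    {X | instability (M t) (W t) u X ∈ A}

end Measurability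

/-! ### The past and its independence of the current noise. -/

section Past

variable {I J Ω : Type*} {T : ℕ} {M : ℕ → Finset I} {W : ℕ → Finset J}

/-- The `σ`-algebra generated by the noise of the arriving agents in the rounds before `t`. -/
abbrev past (M : ℕ → Finset I) (W : ℕ → Finset J) (T : ℕ) (ε : ℕ → I ⊕ J → Ω → ℝ) (t : ℕ) :
    MeasurableSpace Ω :=
  ⨆ p ∈ {p : {p : ℕ × (I ⊕ J) // p.1 < T ∧ p.2 ∈ (M p.1).disjSum (W p.1)} | p.1.1 < t},
    MeasurableSpace.comap (ε p.1.1 p.1.2) inferInstance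

theorem measurable_past {ε : ℕ → I ⊕ J → Ω → ℝ} {t s : ℕ} (ht : t ≤ T) (hs : s < t) {a : I ⊕ J}
    (ha : a ∈ (M s).disjSum (W s)) : Measurable[past M W T ε t] (ε s a) :=
  measurable_iff_comap_le.2 (le_iSup₂_of_le ⟨(s, a), by omega, ha⟩ hs le_rfl)

variable [mΩ : MeasurableSpace Ω] {P : Measure Ω}
  {ε : ℕ → I ⊕ J → Ω → ℝ}

theorem past_le (hε : ∀ t < T, ∀ a ∈ (M t).disjSum (W t), Measurable (ε t a)) (t : ℕ) :
    past M W T ε t ≤ mΩ :=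
  iSup₂_le fun p _ => measurable_iff_comap_le.1 (hε _ p.2.1 _ p.2.2)

/-- The two σ-algebras are generated by disjoint subfamilies of an independent family: the indices
before `t`, and the single index `(t, a)`. -/
theorem indep_past (hε : ∀ t < T, ∀ a ∈ (M t).disjSum (W t), Measurable (ε t a))
    (hind : iIndepFun (fun p : {p : ℕ × (I ⊕ J) // p.1 < T ∧ p.2 ∈ (M p.1).disjSum (W p.1)} =>
      ε p.1.1 p.1.2) P) {t : ℕ} (ht : t < T) {a : I ⊕ J} (ha : a ∈ (M t).disjSum (W t)) :
    Indep (past M W T ε t) (MeasurableSpace.comap (ε t a) inferInstance) P := by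
  have h := indep_iSup_of_disjoint (fun p => measurable_iff_comap_le.1 (hε _ p.2.1 _ p.2.2))
    hind.iIndep
    (S := {p : {p : ℕ × (I ⊕ J) // p.1 < T ∧ p.2 ∈ (M p.1).disjSum (W p.1)} | p.1.1 < t})
    (T := {⟨(t, a), ht, ha⟩}) (by simp)
  simpa [past] using h

/-- The factor that one observation contributes to the supermartingale. The form with `∫⁻` avoids
integrability conditions on the products. -/
theorem lintegral_exp_le_one {X : Ω → ℝ} (hX : HasSubgaussianMGF X 1 P) (l : ℝ) :
    ∫⁻ ω, ENNReal.ofReal (Real.exp (l * X ω - l ^ 2 / 2)) ∂P ≤ 1 := by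
  simp only [Real.exp_sub, div_eq_mul_inv]
  rw [← ofReal_integral_eq_lintegral_ofReal ((hX.integrable_exp_mul l).mul_const _)
    (Filter.Eventually.of_forall fun ω => by positivity), integral_mul_const,
    ENNReal.ofReal_le_one, ← div_eq_mul_inv, div_le_one (by positivity)]
  simpa [mgf, div_eq_mul_inv] using hX.mgf_le l

end Past

/-! ### Concentration of the noise sums and the expected regret. -/

section Concentration

variable {I J : Type*} [DecidableEq I] [DecidableEq J] [Fintype I] [Fintype J]
  {G : Finset I → Finset J → (I ⊕ J → I ⊕ J → ℝ) → Finset (I × J)} {e : ℝ} {T : ℕ}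
  {M : ℕ → Finset I} {W : ℕ → Finset J} {u : I ⊕ J → I ⊕ J → ℝ}
  {Ω : Type*}

variable [MeasurableSpace Ω] {P : Measure Ω} [IsProbabilityMeasure P] {ε : ℕ → I ⊕ J → Ω → ℝ}

/-- The exponential supermartingale of the noise that `a` observes when it is matched to `b`. -/
theorem lintegral_exp_noiseSum_le_one (hG : IsGSVersion G)
    (hε : ∀ t < T, ∀ a ∈ (M t).disjSum (W t), Measurable (ε t a))
    (hsub : ∀ t < T, ∀ a ∈ (M t).disjSum (W t), HasSubgaussianMGF (ε t a) 1 P)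
    (hind : iIndepFun (fun p : {p : ℕ × (I ⊕ J) // p.1 < T ∧ p.2 ∈ (M p.1).disjSum (W p.1)} =>
      ε p.1.1 p.1.2) P) (l : ℝ) (a b : I ⊕ J) (t : ℕ) (ht : t ≤ T) :
    ∫⁻ ω, ENNReal.ofReal (Real.exp (l * noiseSum G e T M W u (fun t a => ε t a ω) t a b -
      l ^ 2 / 2 * (matchNTUUCB G e T M W u (fun t a => ε t a ω) t).count a b)) ∂P ≤ 1 := by
  classical
  induction t with
  | zero => simp [noiseSum, matchNTUUCB, UCBState.init]
  | succ t ih =>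
    have ih := ih (by omega)
    set F : Ω → ENNReal := fun ω =>
      ENNReal.ofReal (Real.exp (l * noiseSum G e T M W u (fun t a => ε t a ω) t a b -
        l ^ 2 / 2 * (matchNTUUCB G e T M W u (fun t a => ε t a ω) t).count a b)) with hF
    simp only [noiseSum_succ, count_succ]
    set S : Set Ω := {ω | Matched (chosenMatching G e T M W u (fun t a => ε t a ω) t) a b} with hS
    by_cases ha : a ∈ (M t).disjSum (W t)
    · set g : Ω → ENNReal := fun ω => ENNReal.ofReal (Real.exp (l * ε t a ω - l ^ 2 / 2)) with hg
      have hpast : ∀ s < t, ∀ a ∈ (M s).disjSum (W s), Measurable[past M W T ε t] (ε s a) :=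
        fun s hs a ha => measurable_past (by omega) hs ha
      have hSm : MeasurableSet[past M W T ε t] S :=
        @measurableSet_chosenMatching I J _ _ _ _ G e T M W u Ω (past M W T ε t) ε hG t hpast
          {X | Matched X a b}
      have hFm : Measurable[past M W T ε t] F := by
        have h1 := @measurable_noiseSum I J _ _ _ _ G e T M W u Ω (past M W T ε t) ε hG t hpast a b
        have h2 := (@measurable_count_and_mean I J _ _ _ _ G e T M W u Ω (past M W T ε t) ε hG t
          hpast).1 a b
        have h3 : Measurable[past M W T ε t] fun ω =>
            ((matchNTUUCB G e T M W u (fun t a => ε t a ω) t).count a b : ℝ) :=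
          measurable_from_top.comp h2
        exact ((h1.const_mul l).sub (h3.const_mul _)).exp.ennreal_ofReal
      have hle := past_le hε t
      have hgm : Measurable[MeasurableSpace.comap (ε t a) inferInstance] g :=
        (((comap_measurable (ε t a)).const_mul l).sub_const _).exp.ennreal_ofReal
      -- Off `S` nothing changes; on `S` the process gains the factor `g`. Both `S` and `F` belong
      -- to the past, so `g` is independent of `S.indicator F` and integrates separately.
      have heq : ∀ ω, ENNReal.ofReal (Real.exp (l *
          (if Matched (chosenMatching G e T M W u (fun t a => ε t a ω) t) a b then
            noiseSum G e T M W u (fun t a => ε t a ω) t a b + ε t a ω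
            else noiseSum G e T M W u (fun t a => ε t a ω) t a b) -
          l ^ 2 / 2 * ((if Matched (chosenMatching G e T M W u (fun t a => ε t a ω) t) a b then
            (matchNTUUCB G e T M W u (fun t a => ε t a ω) t).count a b + 1
            else (matchNTUUCB G e T M W u (fun t a => ε t a ω) t).count a b : ℕ) : ℝ))) =
          Sᶜ.indicator F ω + S.indicator F ω * g ω := by
        intro ω
        by_cases h : Matched (chosenMatching G e T M W u (fun t a => ε t a ω) t) a b
        · have hω : ω ∈ S := h
          rw [if_pos h, if_pos h, Set.indicator_of_notMem (by simpa using hω),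
            Set.indicator_of_mem hω, zero_add, hF, hg, ← ENNReal.ofReal_mul (by positivity),
            ← Real.exp_add]
          congr 2
          push_cast
          ring
        · have hω : ω ∉ S := h
          rw [if_neg h, if_neg h, Set.indicator_of_mem (by simpa using hω),
            Set.indicator_of_notMem hω, zero_mul, add_zero]
      simp only [heq]
      rw [lintegral_add_left ((hFm.mono hle le_rfl).indicator (hle _ hSm).compl),
        lintegral_mul_eq_lintegral_mul_lintegral_of_independent_measurableSpace hle
          (measurable_iff_comap_le.1 (hε t (by omega) a ha)) (indep_past hε hind (by omega) ha)
          (hFm.indicator hSm) hgm]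
      calc _ ≤ (∫⁻ ω, Sᶜ.indicator F ω ∂P) + (∫⁻ ω, S.indicator F ω ∂P) * 1 := by
            gcongr
            exact lintegral_exp_le_one (hsub t (by omega) a ha) l
        _ = ∫⁻ ω, F ω ∂P := by
            rw [mul_one, lintegral_indicator (hle _ hSm).compl, lintegral_indicator (hle _ hSm),
              add_comm, lintegral_add_compl _ (hle _ hSm)]
        _ ≤ 1 := ih
    · have hno : ∀ ω, ¬ Matched (chosenMatching G e T M W u (fun t a => ε t a ω) t) a b :=
        fun ω h => ha (h.mem_disjSum (hG.isStable _ _ _).isMatching)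
      simpa only [hno, if_false] using ih

/-- The event that after `n` observations the observed noise is large in the direction `σ`. -/
def deviation (G : Finset I → Finset J → (I ⊕ J → I ⊕ J → ℝ) → Finset (I × J)) (e : ℝ) (T : ℕ)
    (M : ℕ → Finset I) (W : ℕ → Finset J) (u : I ⊕ J → I ⊕ J → ℝ) (ε : ℕ → I ⊕ J → Ω → ℝ) (L : ℝ)
    (t : ℕ) (a b : I ⊕ J) (n : ℕ) (σ : ℝ) : Set Ω :=
  {ω | (matchNTUUCB G e T M W u (fun t a => ε t a ω) t).count a b = n} ∩
    {ω | 8 * √(L * n) < σ * noiseSum G e T M W u (fun t a => ε t a ω) t a b}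

/-- The count is fixed to a deterministic `n` so that the exponent `l` may depend on it. The choice
`l = σ · 8 √(L / n)` maximises `l σ · 8 √(L n) - l ^ 2 n / 2`, with value `64 L - 32 L = 32 L`. -/
theorem measure_deviation_le (hG : IsGSVersion G)
    (hε : ∀ t < T, ∀ a ∈ (M t).disjSum (W t), Measurable (ε t a))
    (hsub : ∀ t < T, ∀ a ∈ (M t).disjSum (W t), HasSubgaussianMGF (ε t a) 1 P)
    (hind : iIndepFun (fun p : {p : ℕ × (I ⊕ J) // p.1 < T ∧ p.2 ∈ (M p.1).disjSum (W p.1)} =>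
      ε p.1.1 p.1.2) P) {L : ℝ} (hL : 0 ≤ L) (t : ℕ) (ht : t ≤ T) (a b : I ⊕ J) (n : ℕ) {σ : ℝ}
    (hσ : σ ^ 2 = 1) :
    P (deviation G e T M W u ε L t a b n σ) ≤ ENNReal.ofReal (Real.exp (-(32 * L))) := by
  rcases Nat.eq_zero_or_pos n with rfl | hn
  -- Without observations both sides of the strict inequality are `0`.
  · have : deviation G e T M W u ε L t a b 0 σ = ∅ := by
      refine Set.eq_empty_of_forall_notMem fun ω hω => ?_
      have h1 : (matchNTUUCB G e T M W u (fun t a => ε t a ω) t).count a b = 0 := hω.1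
      have h2 := hω.2
      simp [noiseSum, h1] at h2
    rw [this]
    simp
  have hn0 : (0 : ℝ) < n := by exact_mod_cast hn
  have h1 := lintegral_exp_noiseSum_le_one (e := e) (u := u) hG hε hsub hind (σ * (8 * √(L / n)))
    a b t ht
  have hmeas : Measurable fun ω => ENNReal.ofReal (Real.exp (σ * (8 * √(L / n)) *
      noiseSum G e T M W u (fun t a => ε t a ω) t a b - (σ * (8 * √(L / n))) ^ 2 / 2 *
        (matchNTUUCB G e T M W u (fun t a => ε t a ω) t).count a b)) := by
    have hη : ∀ s < t, ∀ a ∈ (M s).disjSum (W s), Measurable (ε s a) := fun s hs => hε s (by omega)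
    have h2 : Measurable fun ω =>
        ((matchNTUUCB G e T M W u (fun t a => ε t a ω) t).count a b : ℝ) :=
      measurable_from_top.comp ((measurable_count_and_mean hG t hη).1 a b)
    exact (((measurable_noiseSum hG t hη a b).const_mul _).sub
      (h2.const_mul _)).exp.ennreal_ofReal
  have h2 := (mul_meas_ge_le_lintegral₀ hmeas.aemeasurable
    (ENNReal.ofReal (Real.exp (32 * L)))).trans h1
  have hsubset : deviation G e T M W u ε L t a b n σ ⊆ {ω | ENNReal.ofReal (Real.exp (32 * L)) ≤
      ENNReal.ofReal (Real.exp (σ * (8 * √(L / n)) *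
      noiseSum G e T M W u (fun t a => ε t a ω) t a b - (σ * (8 * √(L / n))) ^ 2 / 2 *
        (matchNTUUCB G e T M W u (fun t a => ε t a ω) t).count a b))} := by
    rintro ω ⟨hc, hz⟩
    simp only [Set.mem_ofPred_eq] at hc hz ⊢
    refine ENNReal.ofReal_le_ofReal (Real.exp_le_exp.2 ?_)
    rw [hc]
    have hsq : √(L / n) ^ 2 * n = L := by
      rw [Real.sq_sqrt (by positivity)]
      field_simp
    have hprod : √(L / n) * √(L * n) = L := by
      rw [← Real.sqrt_mul (by positivity), show L / n * (L * n) = L ^ 2 by field_simp,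
        Real.sqrt_sq hL]
    have h3 : (σ * (8 * √(L / n))) ^ 2 / 2 * n = 32 * L := by
      linear_combination 32 * √(L / n) ^ 2 * n * hσ + 32 * hsq
    have h4 := mul_le_mul_of_nonneg_left hz.le (Real.sqrt_nonneg (L / n))
    rw [h3]
    linarith
  have h3 : P (deviation G e T M W u ε L t a b n σ) * ENNReal.ofReal (Real.exp (32 * L)) ≤ 1 := by
    rw [mul_comm]
    exact (mul_le_mul_right (measure_mono hsubset) _).trans h2
  rw [Real.exp_neg, ENNReal.ofReal_inv_of_pos (by positivity)]
  exact ENNReal.le_inv_iff_mul_le.2 h3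

theorem measurableSet_deviation (hG : IsGSVersion G)
    (hε : ∀ t < T, ∀ a ∈ (M t).disjSum (W t), Measurable (ε t a)) (L : ℝ) (t : ℕ) (ht : t ≤ T)
    (a b : I ⊕ J) (n : ℕ) (σ : ℝ) : MeasurableSet (deviation G e T M W u ε L t a b n σ) := by
  have hη : ∀ s < t, ∀ a ∈ (M s).disjSum (W s), Measurable (ε s a) := fun s hs => hε s (by omega)
  exact ((measurable_count_and_mean hG t hη).1 a b (measurableSet_singleton n)).inter
    (measurableSet_lt measurable_const ((measurable_noiseSum hG t hη a b).const_mul _))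

/-- The regret is small outside an event of small probability. -/
theorem exists_measurableSet_regret_le (hG : IsGSVersion G) (hu : IsUnstructured u)
    (hε : ∀ t < T, ∀ a ∈ (M t).disjSum (W t), Measurable (ε t a))
    (hsub : ∀ t < T, ∀ a ∈ (M t).disjSum (W t), HasSubgaussianMGF (ε t a) 1 P)
    (hind : iIndepFun (fun p : {p : ℕ × (I ⊕ J) // p.1 < T ∧ p.2 ∈ (M p.1).disjSum (W p.1)} =>
      ε p.1.1 p.1.2) P) (hL : 1 / 2 ≤ Real.log ((Fintype.card (I ⊕ J) : ℝ) * T)) :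
    ∃ B : Set Ω, MeasurableSet B ∧
      P.real B ≤ 2 * ((Fintype.card (I ⊕ J) : ℝ) * T) ^ 2 *
        Real.exp (-(32 * Real.log ((Fintype.card (I ⊕ J) : ℝ) * T))) ∧
      ∀ ω ∉ B, regret G e T M W u (fun t a => ε t a ω) ≤
        40 * √(Real.log ((Fintype.card (I ⊕ J) : ℝ) * T)) *
          √((Fintype.card (I ⊕ J) : ℝ) ^ 2 * (T * Fintype.card (I ⊕ J))) := by
  classical
  set L := Real.log ((Fintype.card (I ⊕ J) : ℝ) * T) with hL_def
  -- Indices are round, ordered pair, count and sign. Before round `T` the count is less than `T`,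
  -- so there are `2 (N T) ^ 2` events.
  let idx : Finset (ℕ × (I ⊕ J) × (I ⊕ J) × ℕ × Bool) :=
    Finset.range T ×ˢ Finset.univ ×ˢ Finset.univ ×ˢ Finset.range T ×ˢ Finset.univ
  let D (p : ℕ × (I ⊕ J) × (I ⊕ J) × ℕ × Bool) : Set Ω :=
    deviation G e T M W u ε L p.1 p.2.1 p.2.2.1 p.2.2.2.1 (if p.2.2.2.2 then 1 else -1)
  have hidx : ∀ p ∈ idx, p.1 ≤ T := fun p hp => by
    simp only [idx, Finset.mem_product, Finset.mem_range] at hp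
    omega
  refine ⟨⋃ p ∈ idx, D p, Finset.measurableSet_biUnion _ fun p hp =>
    measurableSet_deviation hG hε L _ (hidx p hp) _ _ _ _, ?_, fun ω hω => ?_⟩
  · refine ENNReal.toReal_le_of_le_ofReal (by positivity) ?_
    calc P (⋃ p ∈ idx, D p) ≤ ∑ p ∈ idx, P (D p) := measure_biUnion_finset_le _ _
      _ ≤ ∑ _p ∈ idx, ENNReal.ofReal (Real.exp (-(32 * L))) :=
        Finset.sum_le_sum fun p hp => measure_deviation_le hG hε hsub hind (by linarith) _
          (hidx p hp) _ _ _ (by split_ifs <;> norm_num)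
      _ = ENNReal.ofReal (2 * ((Fintype.card (I ⊕ J) : ℝ) * T) ^ 2 * Real.exp (-(32 * L))) := by
        rw [Finset.sum_const, nsmul_eq_mul, ENNReal.ofReal_mul (by positivity),
          ← ENNReal.ofReal_natCast]
        congr 2
        simp only [idx, Finset.card_product, Finset.card_range, Finset.card_univ, Fintype.card_bool]
        push_cast
        ring
  · refine regret_le_of_noiseSum_le hG hu hL fun t ht a b => ?_
    simp only [Set.mem_iUnion, not_exists] at hω
    have hn := (count_le G e T M W u (fun t a => ε t a ω) t a b).trans_lt ht
    refine abs_le'.2 ⟨?_, ?_⟩ <;> by_contra! h <;> rw [← hL_def] at h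
    · refine hω (t, a, b, (matchNTUUCB G e T M W u (fun t a => ε t a ω) t).count a b, true)
        (by simp [idx, ht, hn]) ⟨rfl, ?_⟩
      simpa using h
    · refine hω (t, a, b, (matchNTUUCB G e T M W u (fun t a => ε t a ω) t).count a b, false)
        (by simp [idx, ht, hn]) ⟨rfl, ?_⟩
      simpa using h

theorem integrable_regret (hG : IsGSVersion G) (hu : IsUnstructured u)
    (hε : ∀ t < T, ∀ a ∈ (M t).disjSum (W t), Measurable (ε t a)) :
    Integrable (fun ω => regret G e T M W u (fun t a => ε t a ω)) P :=
  Integrable.of_bound (measurable_regret hG hε).aestronglyMeasurable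
    (2 * (Fintype.card (I ⊕ J) * T)) (Filter.Eventually.of_forall fun ω => by
      rw [Real.norm_of_nonneg (regret_nonneg _ _ _ _ _ _ _)]
      exact regret_le_card hu)

/-- With `x = N T`, the exceptional event has probability at most `2 x ^ 2 · x⁻³` and regret at most
`2 x`, so it contributes at most `4`. Since `√L ≥ 1 / 2` and the root factor `r` is at least `1`, `4
≤ 8 r √L`; hence `48 = 40 + 8`. -/
theorem integral_regret_le (hG : IsGSVersion G) (hu : IsUnstructured u)
    (hε : ∀ t < T, ∀ a ∈ (M t).disjSum (W t), Measurable (ε t a))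
    (hsub : ∀ t < T, ∀ a ∈ (M t).disjSum (W t), HasSubgaussianMGF (ε t a) 1 P)
    (hind : iIndepFun (fun p : {p : ℕ × (I ⊕ J) // p.1 < T ∧ p.2 ∈ (M p.1).disjSum (W p.1)} =>
      ε p.1.1 p.1.2) P) :
    ∫ ω, regret G e T M W u (fun t a => ε t a ω) ∂P ≤
      48 * (Fintype.card (I ⊕ J) : ℝ) ^ (3 / 2 : ℝ) * √(T : ℝ) *
        √(Real.log ((Fintype.card (I ⊕ J) : ℝ) * T)) := by
  rcases Nat.lt_or_ge 1 (Fintype.card (I ⊕ J) * T) with hNT | hNT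
  swap
  -- For `N T ≤ 1` the right-hand side is `0`, so the regret has to vanish exactly.
  · simp only [regret_eq_zero hG hu hNT, integral_zero]
    positivity
  have hx : (2 : ℝ) ≤ (Fintype.card (I ⊕ J) : ℝ) * T := by exact_mod_cast hNT
  have hL : 1 / 2 ≤ Real.log ((Fintype.card (I ⊕ J) : ℝ) * T) := by
    have := Real.log_le_log (by norm_num) hx
    linarith [Real.log_two_gt_d9]
  obtain ⟨B, hB, hPB, hreg⟩ := exists_measurableSet_regret_le (e := e) hG hu hε hsub hind hL
  have hroot : √((Fintype.card (I ⊕ J) : ℝ) ^ 2 * (T * Fintype.card (I ⊕ J))) =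
      (Fintype.card (I ⊕ J) : ℝ) ^ (3 / 2 : ℝ) * √(T : ℝ) := by
    have h0 : (0 : ℝ) ≤ Fintype.card (I ⊕ J) := Nat.cast_nonneg _
    rw [show (Fintype.card (I ⊕ J) : ℝ) ^ 2 * (T * Fintype.card (I ⊕ J)) =
      (Fintype.card (I ⊕ J) : ℝ) ^ 3 * T by ring, Real.sqrt_mul (by positivity),
      Real.sqrt_eq_rpow, ← Real.rpow_natCast, ← Real.rpow_mul h0]
    norm_num
  have hone : 1 ≤ √((Fintype.card (I ⊕ J) : ℝ) ^ 2 * (T * Fintype.card (I ⊕ J))) := by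
    rw [Real.one_le_sqrt]
    have : 1 ≤ Fintype.card (I ⊕ J) ^ 2 * (T * Fintype.card (I ⊕ J)) := by
      have h1 : 0 < Fintype.card (I ⊕ J) * T := by omega
      have h2 : 0 < Fintype.card (I ⊕ J) := Nat.pos_of_mul_pos_right h1
      have h3 : 0 < T := Nat.pos_of_mul_pos_left h1
      exact Nat.succ_le_of_lt (by positivity)
    exact_mod_cast this
  have hhalf : (1 : ℝ) / 2 ≤ √(Real.log ((Fintype.card (I ⊕ J) : ℝ) * T)) :=
    Real.le_sqrt_of_sq_le (by linarith)
  -- The exponential equals `x ^ (-32)` for `x = N T`; the third power is already enough.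
  have hexp : Real.exp (-(32 * Real.log ((Fintype.card (I ⊕ J) : ℝ) * T))) ≤
      (((Fintype.card (I ⊕ J) : ℝ) * T) ^ 3)⁻¹ := by
    have hpos : 0 < (Fintype.card (I ⊕ J) : ℝ) * T := by linarith
    rw [← Real.exp_log (inv_pos.2 (pow_pos hpos 3)), Real.log_inv, Real.log_pow]
    refine Real.exp_le_exp.2 ?_
    push_cast
    linarith
  rw [mul_assoc (48 : ℝ), ← hroot]
  generalize √((Fintype.card (I ⊕ J) : ℝ) ^ 2 * (T * Fintype.card (I ⊕ J))) = r at *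
  generalize hLg : Real.log ((Fintype.card (I ⊕ J) : ℝ) * T) = L at *
  calc ∫ ω, regret G e T M W u (fun t a => ε t a ω) ∂P
      ≤ ∫ ω, (40 * √L * r + B.indicator (fun _ => 2 * ((Fintype.card (I ⊕ J) : ℝ) * T)) ω) ∂P := by
        refine integral_mono (integrable_regret hG hu hε) ((integrable_const _).add
          ((integrable_const _).indicator hB)) fun ω => ?_
        by_cases hω : ω ∈ B
        · simp only [Set.indicator_of_mem hω]
          have := regret_le_card (G := G) (e := e) (T := T) (M := M) (W := W)
            (η := fun t a => ε t a ω) hu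
          have h0 : 0 ≤ 40 * √L * r := by positivity
          linarith
        · simpa only [Set.indicator_of_notMem hω, add_zero] using hreg ω hω
    _ = 40 * √L * r + P.real B * (2 * ((Fintype.card (I ⊕ J) : ℝ) * T)) := by
        rw [integral_add (integrable_const _) ((integrable_const _).indicator hB),
          integral_indicator_const _ hB]
        simp
    _ ≤ 40 * √L * r + 4 := by
        have hx0 : 0 < (Fintype.card (I ⊕ J) : ℝ) * T := by linarith
        generalize (Fintype.card (I ⊕ J) : ℝ) * T = x at *
        gcongr
        calc P.real B * (2 * x) ≤ (2 * x ^ 2 * (x ^ 3)⁻¹) * (2 * x) := by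
              gcongr
              exact hPB.trans (by gcongr)
          _ = 4 := by
              field_simp
              norm_num
    _ ≤ 48 * r * √L := by nlinarith

end Concentration

end NTU

theorem theorem6p3 :
    ∃ C : ℝ, 0 < C ∧
      ∀ (I J : Type*) [Fintype I] [Fintype J] [DecidableEq I] [DecidableEq J],
        (∃ G : Finset I → Finset J → (I ⊕ J → I ⊕ J → ℝ) → Finset (I × J), NTU.IsGSVersion G) ∧
        ∀ (G : Finset I → Finset J → (I ⊕ J → I ⊕ J → ℝ) → Finset (I × J)),
          NTU.IsGSVersion G →
          (∀ M W v, NTU.IsMatching M W (G M W v)) ∧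
          ∀ (e : ℝ) (T : ℕ) (M : ℕ → Finset I) (W : ℕ → Finset J)
            (u : I ⊕ J → I ⊕ J → ℝ), NTU.IsUnstructured u →
          ∀ (Ω : Type*) [MeasurableSpace Ω] (P : Measure Ω) [IsProbabilityMeasure P]
            (ε : ℕ → I ⊕ J → Ω → ℝ),
            (∀ t < T, ∀ a ∈ (M t).disjSum (W t), Measurable (ε t a)) →
            (∀ t < T, ∀ a ∈ (M t).disjSum (W t), HasSubgaussianMGF (ε t a) 1 P) →
            iIndepFun
              (fun p : {p : ℕ × (I ⊕ J) // p.1 < T ∧ p.2 ∈ (M p.1).disjSum (W p.1)} =>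
                ε p.1.1 p.1.2) P →
            Integrable (fun ω => NTU.regret G e T M W u (fun t a => ε t a ω)) P ∧
            ∫ ω, NTU.regret G e T M W u (fun t a => ε t a ω) ∂P ≤
              C * (Fintype.card (I ⊕ J) : ℝ) ^ (3 / 2 : ℝ) * √(T : ℝ) *
                √(Real.log ((Fintype.card (I ⊕ J) : ℝ) * T)) := by
  refine ⟨48, by norm_num, fun I J _ _ _ _ => ⟨NTU.exists_isGSVersion, fun G hG =>
    ⟨fun M W v => (hG.isStable M W v).isMatching, ?_⟩⟩⟩
  intro e T M W u hu Ω _ P _ ε hε hsub hind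
  exact ⟨NTU.integrable_regret hG hu hε, NTU.integral_regret_le hG hu hε hsub hind⟩
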